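/- Let $n\ge 8$. For a simple graph $G$ of order $n$, let $\alpha(G)$ be its stability number (the maximum size of a stable set) and $F(G)$ its Fibonacci index (the number of stable sets of $G$, including the empty set). Let $\mathcal P_{\mathcal C(n)}\subset\mathbb R^2$ be the convex hull of all points $(\alpha(G),F(G))$, where $G$ ranges over the connected graphs of order $n$. Then $\mathcal P_{\mathcal C(n)}$ has exactly $n-1$ facets, and they are defined by the inequalities $$y\ \ge\ (2^k-1)\,x+2^k(1-k)+n,\qquad k=1,2,\dots,n-2,$$ $$y\ \le\ \frac{2^{n-1}-n}{n-2}\,(x-1)+n+1 .$$ That is, these $n-1$ inequalities form a complete and minimal description of $\mathcal P_{\mathcal C(n)}$ (it is their solution set, and not the solution set of any proper subsystem), each of them defines a facet (the set of points of $\mathcal P_{\mathcal C(n)}$ where it holds with equality), and every facet arises in this way. Moreover, the line $y=\frac{2^{n-1}-n}{n-2}(x-1)+n+1$ is the line through the two points $(\alpha(G),F(G))$ corresponding to the complete graph $G=K_n$ and the star $G=S_n$. -/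

import Mathlib

/-- The Fibonacci index (Merrifield-Simmons index) of a graph: the number of its stable
(independent) sets of vertices, the empty set included. -/
noncomputable def fibonacciIndex {V : Type*} (G : SimpleGraph V) : ℕ :=
  Nat.card {s : Finset V // G.IsIndepSet (s : Set V)}

/-- The point `(α(G), F(G))` of the plane that corresponds to the graph `G`. -/
noncomputable def graphPoint {V : Type*} (G : SimpleGraph V) : ℝ × ℝ :=
  ((G.indepNum : ℝ), (fibonacciIndex G : ℝ))

/-- The polytope of the connected graphs of order `n`: the convex hull of all points
`(α(G), F(G))`, where `G` is a connected graph of order `n`. -/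
noncomputable def connectedPolytope (n : ℕ) : Set (ℝ × ℝ) :=
  convexHull ℝ {p : ℝ × ℝ | ∃ G : SimpleGraph (Fin n), G.Connected ∧ p = graphPoint G}

/-- `B` is a facet of the polytope `P`: a nonempty (exposed) face of `P` whose dimension is one
less than that of `P`. -/
def IsFacet {E : Type*} [NormedAddCommGroup E] [NormedSpace ℝ E] (P B : Set E) : Prop :=
  IsExposed ℝ P B ∧ B.Nonempty ∧
    Module.finrank ℝ (vectorSpan ℝ B) + 1 = Module.finrank ℝ (vectorSpan ℝ P)

/-- The right-hand side `(2 ^ k - 1) x + 2 ^ k (1 - k) + n` of the lower inequalities. -/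
noncomputable def lowerBound (n k : ℕ) (x : ℝ) : ℝ :=
  ((2 : ℝ) ^ k - 1) * x + (2 : ℝ) ^ k * (1 - (k : ℝ)) + (n : ℝ)

/-- The right-hand side `(2 ^ (n - 1) - n) / (n - 2) * (x - 1) + n + 1` of the upper inequality. -/
noncomputable def upperBound (n : ℕ) (x : ℝ) : ℝ :=
  ((2 : ℝ) ^ (n - 1) - (n : ℝ)) / ((n : ℝ) - 2) * (x - 1) + (n : ℝ) + 1

/-- The closed half-planes given by the lower inequalities, for `k = 1, …, n - 2`, and by the
upper inequality. -/
def halfPlanes (n : ℕ) : Set (Set (ℝ × ℝ)) :=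
  {H | ∃ k : ℕ, 1 ≤ k ∧ k ≤ n - 2 ∧ H = {p : ℝ × ℝ | lowerBound n k p.1 ≤ p.2}} ∪
    {{p : ℝ × ℝ | p.2 ≤ upperBound n p.1}}

/-!
The boundary of the polytope carries the points of the complete split graphs, in which `m` stable
vertices are joined to a clique on the other `n - m` vertices. Such a graph has stability number
`m` and Fibonacci index `2 ^ m - m + n`. Any graph with a stable set of `m` vertices is a subgraph
of the complete split graph on it and has more stable sets; as `2 ^ m - m + n` is convex in `m`,
this gives the lower inequalities.

For the upper inequality, branch on a vertex `v`: `F(G) = F(G - v) + F(G - N[v])`. By induction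
`F(G) ≤ c ^ α(G) * r ^ n` for suitable `c` and `r`. A connected graph has at least `n - 1` edges,
all of them covered by the complement of a maximum stable set, hence it has a vertex `v` of degree
at least `(n - 1) / (n - α(G))`; one branching step at `v`, followed by the geometric bound with
`c = 4 / 3` and `r = 3 / 2`, gives the inequality except in a few small cases.

Finally, a system of linear inequalities is an irredundant description of a full-dimensional
polyhedron as soon as each inequality is tight at a point where all the others are strict, and its
facets then correspond to the inequalities. Here such a point is the midpoint of the edge.
-/

section StableSets

variable {V : Type*} {G : SimpleGraph V}

/-- The closed neighborhood `N[v]` of a vertex. -/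
def closedNeighborSet (G : SimpleGraph V) (v : V) : Set V := insert v (G.neighborSet v)

lemma isIndepSet_map_subtype {U : Set V} {s : Finset U} :
    G.IsIndepSet (s.map (Function.Embedding.subtype (· ∈ U)) : Set V) ↔
      (G.induce U).IsIndepSet (s : Set U) := by
  rw [Finset.coe_map]
  exact Subtype.val_injective.injOn.pairwise_image

lemma isIndepSet_insert_iff {s : Set V} {v : V} (hv : v ∉ s) :
    G.IsIndepSet (insert v s) ↔ s ⊆ (closedNeighborSet G v)ᶜ ∧ G.IsIndepSet s := by
  rw [← SimpleGraph.isClique_compl, SimpleGraph.isClique_insert_of_notMem hv,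
    SimpleGraph.isClique_compl, and_comm]
  refine and_congr_left fun _ => forall₂_congr fun w _ => ?_
  simp [closedNeighborSet, SimpleGraph.compl_adj, eq_comm]

lemma fibonacciIndex_eq_ncard (G : SimpleGraph V) :
    fibonacciIndex G = {s : Finset V | G.IsIndepSet (s : Set V)}.ncard := rfl

lemma fibonacciIndex_induce (G : SimpleGraph V) (U : Set V) :
    fibonacciIndex (G.induce U) =
      {s : Finset V | (s : Set V) ⊆ U ∧ G.IsIndepSet (s : Set V)}.ncard := by
  rw [fibonacciIndex_eq_ncard,
    ← Set.ncard_image_of_injective _ (Finset.map_injective (Function.Embedding.subtype (· ∈ U)))]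
  congr 1
  ext s
  constructor
  · rintro ⟨t, ht, rfl⟩
    exact ⟨by simp, isIndepSet_map_subtype.2 ht⟩
  · rintro ⟨hsU, hs⟩
    classical
    obtain ⟨t, rfl⟩ : ∃ t : Finset U, t.map (Function.Embedding.subtype (· ∈ U)) = s :=
      ⟨s.subtype (· ∈ U), Finset.subtype_map_of_mem hsU⟩
    exact ⟨t, isIndepSet_map_subtype.1 hs, rfl⟩

variable [Finite V]

lemma fibonacciIndex_le_two_pow (G : SimpleGraph V) : fibonacciIndex G ≤ 2 ^ Nat.card V := by
  have := Fintype.ofFinite V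
  calc fibonacciIndex G ≤ Nat.card (Finset V) := Finite.card_subtype_le _
    _ = 2 ^ Nat.card V := by simp

lemma fibonacciIndex_eq_add (G : SimpleGraph V) (v : V) :
    fibonacciIndex G =
      fibonacciIndex (G.induce {v}ᶜ) + fibonacciIndex (G.induce (closedNeighborSet G v)ᶜ) := by
  classical
  have hv : ∀ {s : Finset V}, (s : Set V) ⊆ (closedNeighborSet G v)ᶜ → v ∉ s :=
    fun hs hvs => hs hvs (Set.mem_insert v _)
  have hinj : Set.InjOn (insert v)
      {s : Finset V | (s : Set V) ⊆ (closedNeighborSet G v)ᶜ ∧ G.IsIndepSet (s : Set V)} := by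
    intro s hs t ht hst
    rw [← Finset.erase_insert (hv hs.1), ← Finset.erase_insert (hv ht.1)]
    exact congrArg (Finset.erase · v) hst
  rw [fibonacciIndex_eq_ncard, fibonacciIndex_induce, fibonacciIndex_induce,
    ← hinj.ncard_image, ← Set.ncard_union_eq]
  · congr 1
    ext s
    constructor
    · intro hs
      by_cases hvs : v ∈ s
      · have hvt : v ∉ ((s.erase v : Finset V) : Set V) := by simp
        refine Or.inr ⟨s.erase v, (isIndepSet_insert_iff hvt).1 ?_, Finset.insert_erase hvs⟩
        rwa [← Finset.coe_insert, Finset.insert_erase hvs]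
      · exact Or.inl ⟨by simpa using hvs, hs⟩
    · rintro (⟨-, hs⟩ | ⟨t, ht, rfl⟩)
      · exact hs
      · rw [Set.mem_ofPred_eq, Finset.coe_insert]
        exact (isIndepSet_insert_iff (hv ht.1)).2 ht
  · rw [Set.disjoint_left]
    rintro _ hs ⟨t, -, rfl⟩
    exact hs.1 (Finset.mem_insert_self v t) rfl

lemma fibonacciIndex_induce_union_le (G : SimpleGraph V) (U W : Set V) :
    fibonacciIndex (G.induce (U ∪ W)) ≤
      fibonacciIndex (G.induce U) * fibonacciIndex (G.induce W) := by
  classical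
  simp only [fibonacciIndex_induce]
  rw [← Set.ncard_prod]
  refine Set.ncard_le_ncard_of_injOn (fun s => (s.filter (· ∈ U), s.filter (· ∈ W)))
    (fun s hs => ⟨⟨fun _ h => (Finset.mem_filter.1 h).2, hs.2.mono (Finset.filter_subset _ s)⟩,
      fun _ h => (Finset.mem_filter.1 h).2, hs.2.mono (Finset.filter_subset _ s)⟩)
    fun s hs t ht hst => ?_
  have key : ∀ {r : Finset V}, (r : Set V) ⊆ U ∪ W →
      r.filter (· ∈ U) ∪ r.filter (· ∈ W) = r := fun h => by
    rw [← Finset.filter_or]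
    exact Finset.filter_true_of_mem h
  rw [← key hs.1, ← key ht.1, (Prod.mk.inj hst).1, (Prod.mk.inj hst).2]

lemma fibonacciIndex_le_mul (G : SimpleGraph V) (v : V) :
    fibonacciIndex G ≤ (2 ^ (G.neighborSet v).ncard + 1) *
      fibonacciIndex (G.induce (closedNeighborSet G v)ᶜ) := by
  have hV : ({v}ᶜ : Set V) = G.neighborSet v ∪ (closedNeighborSet G v)ᶜ := by
    ext w
    by_cases hw : G.Adj v w
    · simp [closedNeighborSet, hw, hw.ne']
    · simp [closedNeighborSet, hw]
  rw [fibonacciIndex_eq_add G v, add_one_mul, hV]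
  gcongr
  exact (fibonacciIndex_induce_union_le G _ _).trans
    (Nat.mul_le_mul_right _ (fibonacciIndex_le_two_pow _))

lemma indepNum_induce_le (G : SimpleGraph V) (U : Set V) :
    (G.induce U).indepNum ≤ G.indepNum := by
  obtain ⟨s, hs⟩ := (G.induce U).exists_isNIndepSet_indepNum
  rw [← hs.card_eq, ← Finset.card_map (Function.Embedding.subtype _)]
  exact (isIndepSet_map_subtype.2 hs.isIndepSet).card_le_indepNum

lemma indepNum_induce_compl_closedNeighborSet_lt (G : SimpleGraph V) (v : V) :
    (G.induce (closedNeighborSet G v)ᶜ).indepNum < G.indepNum := by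
  obtain ⟨s, hs⟩ := (G.induce (closedNeighborSet G v)ᶜ).exists_isNIndepSet_indepNum
  classical
  have hsub : ((s.map (Function.Embedding.subtype (· ∈ (closedNeighborSet G v)ᶜ)) : Finset V) :
      Set V) ⊆ (closedNeighborSet G v)ᶜ := by simp
  have hv : v ∉ s.map (Function.Embedding.subtype (· ∈ (closedNeighborSet G v)ᶜ)) :=
    fun h => hsub h (Set.mem_insert v _)
  rw [← hs.card_eq, ← Finset.card_map, Nat.lt_iff_add_one_le, ← Finset.card_insert_of_notMem hv]
  refine SimpleGraph.IsIndepSet.card_le_indepNum ?_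
  rw [Finset.coe_insert, isIndepSet_insert_iff (by exact_mod_cast hv)]
  exact ⟨hsub, isIndepSet_map_subtype.2 hs.isIndepSet⟩

lemma card_compl_closedNeighborSet_add (G : SimpleGraph V) (v : V) :
    Nat.card ↥(closedNeighborSet G v)ᶜ + ((G.neighborSet v).ncard + 1) = Nat.card V := by
  rw [← Set.ncard_add_ncard_compl (closedNeighborSet G v), Nat.card_coe_set_eq, add_comm,
    closedNeighborSet, Set.ncard_insert_of_notMem G.notMem_neighborSet_self]

lemma card_compl_singleton_add_one (v : V) : Nat.card ↥({v}ᶜ : Set V) + 1 = Nat.card V := by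
  rw [← Set.ncard_add_ncard_compl {v}, Set.ncard_singleton, Nat.card_coe_set_eq, add_comm]

end StableSets

section GeometricBounds

universe u

lemma pow_mul_pow_mul_le {c r : ℝ} (hc : 1 ≤ c) (hr : 0 ≤ r) {a b m n d : ℕ} (hab : a < b)
    (hmn : m + d = n) : c ^ a * r ^ m * (c * r ^ d) ≤ c ^ b * r ^ n :=
  calc c ^ a * r ^ m * (c * r ^ d) = c ^ (a + 1) * r ^ n := by rw [← hmn]; ring
    _ ≤ c ^ b * r ^ n := by gcongr; exact hab

lemma pow_mul_pow_add_le {c r : ℝ} (hc : 0 ≤ c) (hr : 0 ≤ r) (h : 1 ≤ c * r ^ 2 * (r - 1))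
    (a m : ℕ) : c ^ (a + 1) * r ^ (m + 2) + c ^ a * r ^ m ≤ c ^ (a + 1) * r ^ (m + 3) :=
  calc c ^ (a + 1) * r ^ (m + 2) + c ^ a * r ^ m
      ≤ c ^ (a + 1) * r ^ (m + 2) + c ^ a * r ^ m * (c * r ^ 2 * (r - 1)) := by
        grw [← h, mul_one]
    _ = c ^ (a + 1) * r ^ (m + 3) := by ring

lemma fibonacciIndex_le_geometric_of_induce {c r : ℝ} (hc : 1 ≤ c) (hr : 0 ≤ r) {V : Type u}
    [Finite V] {G : SimpleGraph V} {v : V}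
    (hd : 2 ^ (G.neighborSet v).ncard + 1 ≤ c * r ^ ((G.neighborSet v).ncard + 1))
    (h : (fibonacciIndex (G.induce (closedNeighborSet G v)ᶜ) : ℝ) ≤
      c ^ (G.induce (closedNeighborSet G v)ᶜ).indepNum *
        r ^ Nat.card ↥(closedNeighborSet G v)ᶜ) :
    (fibonacciIndex G : ℝ) ≤ c ^ G.indepNum * r ^ Nat.card V :=
  calc (fibonacciIndex G : ℝ)
      ≤ (2 ^ (G.neighborSet v).ncard + 1) *
        fibonacciIndex (G.induce (closedNeighborSet G v)ᶜ) := by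
        exact_mod_cast fibonacciIndex_le_mul G v
    _ ≤ (c * r ^ ((G.neighborSet v).ncard + 1)) * (c ^ _ * r ^ _) := by gcongr
    _ ≤ c ^ G.indepNum * r ^ Nat.card V := by
        rw [mul_comm]
        exact pow_mul_pow_mul_le hc hr (indepNum_induce_compl_closedNeighborSet_lt G v)
          (card_compl_closedNeighborSet_add G v)

lemma fibonacciIndex_le_of_geometric {c r : ℝ} (hc : 1 ≤ c) (hr : 1 ≤ r) (h₀ : 2 ≤ c * r)
    (h₁ : 3 ≤ c * r ^ 2) (h₂ : 1 ≤ c * r ^ 2 * (r - 1)) {V : Type u} [Finite V]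
    (G : SimpleGraph V) : (fibonacciIndex G : ℝ) ≤ c ^ G.indepNum * r ^ Nat.card V := by
  have hr₀ : 0 ≤ r := zero_le_one.trans hr
  induction hn : Nat.card V using Nat.strong_induction_on generalizing V with
  | _ n ih =>
  obtain hV | ⟨⟨v⟩⟩ := isEmpty_or_nonempty V
  · have hF : (fibonacciIndex G : ℝ) ≤ 1 := by
      exact_mod_cast (fibonacciIndex_le_two_pow G).trans (by simp)
    exact hF.trans (one_le_mul_of_one_le_of_one_le (one_le_pow₀ hc) (one_le_pow₀ hr))
  have hcard := card_compl_closedNeighborSet_add G v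
  have hα := indepNum_induce_compl_closedNeighborSet_lt G v
  have hA := ih _ (by omega) (G.induce (closedNeighborSet G v)ᶜ) rfl
  obtain h | h | h : (G.neighborSet v).ncard = 0 ∨ (G.neighborSet v).ncard = 1 ∨
      2 ≤ (G.neighborSet v).ncard := by omega
  · rw [← hn]
    exact fibonacciIndex_le_geometric_of_induce hc hr₀ (by rw [h]; norm_num [h₀]) hA
  · rw [← hn]
    exact fibonacciIndex_le_geometric_of_induce hc hr₀ (by rw [h]; norm_num [h₁]) hA
  · have hcard' := card_compl_singleton_add_one v
    have hB := ih _ (by omega) (G.induce {v}ᶜ) rfl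
    have hαB := indepNum_induce_le G {v}ᶜ
    obtain ⟨m, rfl⟩ : ∃ m, n = m + 3 := ⟨n - 3, by omega⟩
    obtain ⟨a, ha⟩ : ∃ a, G.indepNum = a + 1 := Nat.exists_eq_succ_of_ne_zero (by omega)
    calc (fibonacciIndex G : ℝ)
        = fibonacciIndex (G.induce {v}ᶜ) +
          fibonacciIndex (G.induce (closedNeighborSet G v)ᶜ) := by
          exact_mod_cast fibonacciIndex_eq_add G v
      _ ≤ c ^ (a + 1) * r ^ (m + 2) + c ^ a * r ^ m := by
          refine add_le_add (hB.trans ?_) (hA.trans ?_)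
          · gcongr <;> omega
          · gcongr <;> omega
      _ ≤ c ^ G.indepNum * r ^ (m + 3) := by
          rw [ha]
          exact pow_mul_pow_add_le (zero_le_one.trans hc) hr₀ h₂ a m

variable {V : Type u} [Finite V] {G : SimpleGraph V} {a d : ℕ} {v : V}

lemma fibonacciIndex_le_geometric (ha : G.indepNum ≤ a) :
    (fibonacciIndex G : ℝ) ≤ (4 / 3) ^ a * (3 / 2) ^ Nat.card V := by
  have h : (fibonacciIndex G : ℝ) ≤ (4 / 3) ^ G.indepNum * (3 / 2) ^ Nat.card V := by
    apply fibonacciIndex_le_of_geometric <;> norm_num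
  grw [h, ha]
  norm_num

lemma fibonacciIndex_induce_compl_singleton_le (ha : G.indepNum ≤ a) (v : V) :
    (fibonacciIndex (G.induce {v}ᶜ) : ℝ) ≤ (4 / 3) ^ a * (3 / 2) ^ (Nat.card V - 1) := by
  rw [← card_compl_singleton_add_one v, Nat.add_sub_cancel]
  exact fibonacciIndex_le_geometric ((indepNum_induce_le G _).trans ha)

lemma fibonacciIndex_induce_compl_closedNeighborSet_le (ha : G.indepNum ≤ a)
    (hd : d ≤ (G.neighborSet v).ncard) :
    (fibonacciIndex (G.induce (closedNeighborSet G v)ᶜ) : ℝ) ≤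
      (4 / 3) ^ (a - 1) * (3 / 2) ^ (Nat.card V - 1 - d) := by
  have hα := indepNum_induce_compl_closedNeighborSet_lt G v
  have hcard := card_compl_closedNeighborSet_add G v
  refine (fibonacciIndex_le_geometric (a := a - 1) (by omega)).trans ?_
  gcongr
  · norm_num
  · omega

lemma fibonacciIndex_induce_compl_closedNeighborSet_le_two_pow
    (hd : d ≤ (G.neighborSet v).ncard) :
    fibonacciIndex (G.induce (closedNeighborSet G v)ᶜ) ≤ 2 ^ (Nat.card V - 1 - d) := by
  refine (fibonacciIndex_le_two_pow _).trans (Nat.pow_le_pow_right two_pos ?_)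
  have := card_compl_closedNeighborSet_add G v
  omega

lemma fibonacciIndex_le_two_pow_add_two_pow (hd : d ≤ (G.neighborSet v).ncard) :
    fibonacciIndex G ≤ 2 ^ (Nat.card V - 1) + 2 ^ (Nat.card V - 1 - d) := by
  rw [fibonacciIndex_eq_add G v]
  refine add_le_add ?_ (fibonacciIndex_induce_compl_closedNeighborSet_le_two_pow hd)
  rw [← card_compl_singleton_add_one v, Nat.add_sub_cancel]
  exact fibonacciIndex_le_two_pow _

lemma fibonacciIndex_le_geometric_add_two_pow (ha : G.indepNum ≤ a)
    (hd : d ≤ (G.neighborSet v).ncard) :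
    (fibonacciIndex G : ℝ) ≤
      (4 / 3) ^ a * (3 / 2) ^ (Nat.card V - 1) + 2 ^ (Nat.card V - 1 - d) := by
  rw [fibonacciIndex_eq_add G v, Nat.cast_add]
  exact add_le_add (fibonacciIndex_induce_compl_singleton_le ha v)
    (by exact_mod_cast fibonacciIndex_induce_compl_closedNeighborSet_le_two_pow hd)

lemma fibonacciIndex_le_geometric_add_geometric (ha : G.indepNum ≤ a)
    (hd : d ≤ (G.neighborSet v).ncard) :
    (fibonacciIndex G : ℝ) ≤
      (4 / 3) ^ a * (3 / 2) ^ (Nat.card V - 1) +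
        (4 / 3) ^ (a - 1) * (3 / 2) ^ (Nat.card V - 1 - d) := by
  rw [fibonacciIndex_eq_add G v, Nat.cast_add]
  exact add_le_add (fibonacciIndex_induce_compl_singleton_le ha v)
    (fibonacciIndex_induce_compl_closedNeighborSet_le ha hd)

end GeometricBounds

section ConnectedGraphs

variable {V : Type*} {G : SimpleGraph V}

lemma ncard_neighborSet [Fintype V] [DecidableRel G.Adj] (v : V) :
    (G.neighborSet v).ncard = G.degree v := by
  rw [Set.ncard_eq_toFinset_card', Set.toFinset_card, SimpleGraph.card_neighborSet_eq_degree]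

lemma card_le_card_edgeFinset_add_one [Fintype V] [DecidableRel G.Adj] (hG : G.Connected) :
    Fintype.card V ≤ G.edgeFinset.card + 1 := by
  have := hG.card_vert_le_card_edgeSet_add_one
  rwa [Nat.card_eq_fintype_card, Nat.card_eq_fintype_card, ← SimpleGraph.edgeFinset_card] at this

lemma card_edgeFinset_le_sum_degree_compl [Fintype V] [DecidableEq V] [DecidableRel G.Adj]
    {S : Finset V} (hS : G.IsIndepSet (S : Set V)) :
    G.edgeFinset.card ≤ ∑ v ∈ Sᶜ, G.degree v := by
  have hcover : G.edgeFinset ⊆ Sᶜ.biUnion fun v => G.incidenceFinset v := by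
    intro e he
    rw [SimpleGraph.mem_edgeFinset] at he
    obtain ⟨v, hv, hve⟩ := SimpleGraph.IsIndepSet.nonempty_mem_compl_mem_edge G hS he
    exact Finset.mem_biUnion.2 ⟨v, by simpa using hv, (G.mem_incidenceFinset v e).2 ⟨he, hve⟩⟩
  simpa only [SimpleGraph.card_incidenceFinset_eq_degree] using
    (Finset.card_le_card hcover).trans Finset.card_biUnion_le

lemma exists_card_le_mul_ncard_neighborSet [Finite V] (hG : G.Connected) :
    ∃ v, Nat.card V - 1 ≤ (Nat.card V - G.indepNum) * (G.neighborSet v).ncard := by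
  classical
  have := Fintype.ofFinite V
  have := hG.nonempty
  obtain ⟨S, hS⟩ := G.exists_isNIndepSet_indepNum
  obtain ⟨v, -, hv⟩ := Finset.univ.exists_max_image (fun w => G.degree w) Finset.univ_nonempty
  have hcover := card_edgeFinset_le_sum_degree_compl hS.isIndepSet
  have hsum : ∑ w ∈ Sᶜ, G.degree w ≤ (Fintype.card V - G.indepNum) * G.degree v := by
    rw [← hS.card_eq, ← Finset.card_compl, ← smul_eq_mul]
    exact Finset.sum_le_card_nsmul _ _ _ fun w _ => hv w (Finset.mem_univ w)
  have hedges := card_le_card_edgeFinset_add_one hG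
  refine ⟨v, ?_⟩
  rw [ncard_neighborSet, Nat.card_eq_fintype_card]
  omega

lemma exists_two_le_ncard_neighborSet_induce [Finite V] (hG : G.Connected) {v : V}
    (hv : 2 * (G.neighborSet v).ncard + 1 < Nat.card V) :
    ∃ w : ({v}ᶜ : Set V), 2 ≤ ((G.induce {v}ᶜ).neighborSet w).ncard := by
  classical
  have := Fintype.ofFinite V
  by_contra! h
  simp only [ncard_neighborSet] at h hv
  have hsum := Finset.sum_le_card_nsmul Finset.univ (fun w => (G.induce {v}ᶜ).degree w) 1
    fun w _ => Nat.le_of_lt_succ (h w)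
  rw [SimpleGraph.sum_degrees_eq_twice_card_edges, G.card_edgeFinset_induce_compl_singleton,
    G.card_edgeFinset_deleteIncidenceSet] at hsum
  have hedges := card_le_card_edgeFinset_add_one hG
  have hcard := card_compl_singleton_add_one v
  simp only [Nat.card_eq_fintype_card, Finset.card_univ, smul_eq_mul, mul_one] at *
  omega

end ConnectedGraphs

section CompleteSplit

variable {V : Type*} {S : Finset V}

/-- The complete split graph with stable part `S`: two vertices are adjacent unless both of them
lie in `S`. -/
def completeSplit (S : Finset V) : SimpleGraph V where
  Adj u v := u ≠ v ∧ (u ∉ S ∨ v ∉ S)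
  symm := ⟨fun _ _ h => ⟨h.1.symm, h.2.symm⟩⟩
  loopless := ⟨fun _ h => h.1 rfl⟩

lemma completeSplit_adj {u v : V} : (completeSplit S).Adj u v ↔ u ≠ v ∧ (u ∉ S ∨ v ∉ S) := Iff.rfl

lemma isIndepSet_completeSplit_iff {s : Finset V} :
    (completeSplit S).IsIndepSet (s : Set V) ↔ s ⊆ S ∨ ∃ v ∉ S, s = {v} := by
  constructor
  · intro h
    by_cases hs : s ⊆ S
    · exact Or.inl hs
    · obtain ⟨v, hv, hvS⟩ := Finset.not_subset.1 hs
      refine Or.inr ⟨v, hvS, Finset.eq_singleton_iff_unique_mem.2 ⟨hv, fun w hw => ?_⟩⟩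
      by_contra hwv
      exact h hw hv hwv ⟨hwv, Or.inr hvS⟩
  · rintro (h | ⟨v, -, rfl⟩)
    · exact fun u hu v hv _ huv => huv.2.elim (· (h hu)) (· (h hv))
    · simp [SimpleGraph.IsIndepSet]

lemma connected_completeSplit {c : V} (hc : c ∉ S) : (completeSplit S).Connected := by
  rw [SimpleGraph.connected_iff_exists_forall_reachable]
  refine ⟨c, fun u => ?_⟩
  obtain rfl | hu := eq_or_ne c u
  · rfl
  · exact SimpleGraph.Adj.reachable ⟨hu, Or.inl hc⟩

lemma completeSplit_singleton (c : V) : completeSplit {c} = ⊤ := by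
  ext u v
  simp only [completeSplit_adj, Finset.mem_singleton, SimpleGraph.top_adj, and_iff_left_iff_imp,
    ← not_and_or]
  exact fun h h' => h (h'.1.trans h'.2.symm)

lemma indepNum_completeSplit [Finite V] (hS : S.Nonempty) :
    (completeSplit S).indepNum = S.card := by
  apply le_antisymm
  · obtain ⟨s, hs⟩ := (completeSplit S).exists_isNIndepSet_indepNum
    rw [← hs.card_eq]
    obtain h | ⟨v, -, rfl⟩ := isIndepSet_completeSplit_iff.1 hs.isIndepSet
    · exact Finset.card_le_card h
    · exact (Finset.card_singleton v).trans_le hS.card_pos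
  · exact (isIndepSet_completeSplit_iff.2 (Or.inl subset_rfl)).card_le_indepNum

lemma fibonacciIndex_completeSplit_le [Finite V] {G : SimpleGraph V}
    (hS : G.IsIndepSet (S : Set V)) :
    fibonacciIndex (completeSplit S) ≤ fibonacciIndex G := by
  rw [fibonacciIndex_eq_ncard, fibonacciIndex_eq_ncard]
  refine Set.ncard_le_ncard fun s hs => ?_
  obtain h | ⟨v, -, rfl⟩ := isIndepSet_completeSplit_iff.1 hs
  · exact hS.mono (by exact_mod_cast h)
  · simp [SimpleGraph.IsIndepSet]

variable [Fintype V]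

lemma completeSplit_compl_singleton [DecidableEq V] (c : V) :
    completeSplit {c}ᶜ = SimpleGraph.starGraph c := by
  ext u v
  simp [completeSplit_adj, SimpleGraph.starGraph_adj]

lemma fibonacciIndex_completeSplit (S : Finset V) :
    fibonacciIndex (completeSplit S) = 2 ^ S.card + (Fintype.card V - S.card) := by
  classical
  have hdisj : Disjoint S.powerset
      (Sᶜ.map ⟨fun v => ({v} : Finset V), Finset.singleton_injective⟩) := by
    rw [Finset.disjoint_left]
    intro s hs hs'
    obtain ⟨v, hv, rfl⟩ := Finset.mem_map.1 hs'
    exact Finset.mem_compl.1 hv (Finset.mem_powerset.1 hs (Finset.mem_singleton_self v))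
  have h : {s : Finset V | (completeSplit S).IsIndepSet (s : Set V)} =
      S.powerset.disjUnion _ hdisj := by
    ext s
    simp [isIndepSet_completeSplit_iff, eq_comm]
  rw [fibonacciIndex_eq_ncard, h, Set.ncard_coe_finset, Finset.card_disjUnion,
    Finset.card_powerset, Finset.card_map, Finset.card_compl]

end CompleteSplit

section UpperBound

lemma le_upperBound_iff {n a i j : ℕ} (hn : n = i + j + 2) (ha : a = i + 1) (hij : 0 < i + j)
    (y : ℝ) : y ≤ upperBound n a ↔
      y * (i + j) ≤ i * 2 ^ (i + j + 1) + j * (i + j + 2) + (i + j) := by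
  have h₀ : (0 : ℝ) < i + j := by exact_mod_cast hij
  have h : upperBound n a = (i * 2 ^ (i + j + 1) + j * (i + j + 2) + (i + j)) / (i + j) := by
    rw [upperBound, hn, ha, show i + j + 2 - 1 = i + j + 1 by omega]
    push_cast
    rw [show (i : ℝ) + j + 2 - 2 = i + j by ring]
    field_simp
    ring
  rw [h, le_div_iff₀ h₀]

lemma le_upperBound_of_mul_le {n a i j : ℕ} (hn : n = i + j + 2) (ha : a = i + 1) (hij : 0 < i + j)
    {y b : ℝ} (hy : y ≤ b) (hb : b * (i + j) ≤ i * 2 ^ (i + j + 1)) : y ≤ upperBound n a := by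
  rw [le_upperBound_iff hn ha hij, add_assoc]
  calc y * (i + j) ≤ b * (i + j) := by gcongr
    _ ≤ i * 2 ^ (i + j + 1) := hb
    _ ≤ i * 2 ^ (i + j + 1) + (j * (i + j + 2) + (i + j)) :=
        le_add_of_nonneg_right (by positivity)

lemma four_thirds_pow_mul_three_halves_pow (i j : ℕ) :
    (4 / 3 : ℝ) ^ i * (3 / 2) ^ (i + j) = 2 ^ i * (3 / 2) ^ j := by
  rw [pow_add, ← mul_assoc, ← mul_pow]
  norm_num

lemma add_le_mul_four_thirds_pow {i m₀ m : ℕ} (hi : 1 ≤ i) (hm₀ : 1 ≤ m₀) (hm : m₀ ≤ m)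
    (h : (i + m₀ + 1 : ℝ) ≤ i * (4 / 3) ^ m₀) : (i + m + 1 : ℝ) ≤ i * (4 / 3) ^ m := by
  have hi' : (1 : ℝ) ≤ i := by exact_mod_cast hi
  induction m, hm using Nat.le_induction with
  | base => exact h
  | succ m hm ih =>
    have hm' : (1 : ℝ) ≤ m := by exact_mod_cast hm₀.trans hm
    rw [pow_succ]
    push_cast
    linarith

variable {V : Type*} [Finite V] {G : SimpleGraph V} {i m : ℕ} {v : V}

lemma eq_top_of_indepNum_le_one (h : G.indepNum ≤ 1) : G = ⊤ := by
  classical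
  ext u v
  refine ⟨SimpleGraph.Adj.ne, fun huv => ?_⟩
  by_contra hadj
  have hpair : G.IsIndepSet (({u, v} : Finset V) : Set V) := by
    simp [SimpleGraph.IsIndepSet, Set.pairwise_pair, G.adj_comm v u, hadj]
  have := (Finset.card_pair huv).symm.trans_le hpair.card_le_indepNum
  omega

lemma fibonacciIndex_top [Nonempty V] : fibonacciIndex (⊤ : SimpleGraph V) = Nat.card V + 1 := by
  have := Fintype.ofFinite V
  have c := Classical.arbitrary V
  have hV := Fintype.card_pos (α := V)
  rw [← completeSplit_singleton c, fibonacciIndex_completeSplit, Nat.card_eq_fintype_card,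
    Finset.card_singleton]
  omega

lemma fibonacciIndex_le_upperBound_of_indepNum_eq_one (hα : G.indepNum = 1) :
    (fibonacciIndex G : ℝ) ≤ upperBound (Nat.card V) G.indepNum := by
  obtain ⟨S, hS⟩ := G.exists_isNIndepSet_indepNum
  obtain ⟨v, -⟩ := Finset.card_pos.1 (hS.card_eq.trans hα ▸ one_pos)
  have : Nonempty V := ⟨v⟩
  rw [hα, eq_top_of_indepNum_le_one hα.le, fibonacciIndex_top]
  simp [upperBound]

lemma fibonacciIndex_le_upperBound_of_card_eq_add_two (hi : 1 ≤ i) (hn : Nat.card V = i + 2)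
    (hα : G.indepNum = i + 1) (hd : i + 1 ≤ (G.neighborSet v).ncard) :
    (fibonacciIndex G : ℝ) ≤ upperBound (Nat.card V) G.indepNum := by
  have h : (fibonacciIndex G : ℝ) ≤ 2 ^ (i + 1) + 1 := by
    have := fibonacciIndex_le_two_pow_add_two_pow hd
    rw [hn, show i + 2 - 1 = i + 1 by omega, Nat.sub_self] at this
    exact_mod_cast this
  rw [le_upperBound_iff (j := 0) hn hα hi]
  calc (fibonacciIndex G : ℝ) * (i + (0 : ℕ)) ≤ (2 ^ (i + 1) + 1) * (i + (0 : ℕ)) := by gcongr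
    _ = i * 2 ^ (i + 0 + 1) + (0 : ℕ) * (i + (0 : ℕ) + 2) + (i + (0 : ℕ)) := by push_cast; ring

lemma fibonacciIndex_le_upperBound_of_card_eq_add_three (hi : 5 ≤ i) (hn : Nat.card V = i + 3)
    (hα : G.indepNum = i + 1) (hd : 4 ≤ (G.neighborSet v).ncard) :
    (fibonacciIndex G : ℝ) ≤ upperBound (Nat.card V) G.indepNum := by
  obtain ⟨t, rfl⟩ := Nat.exists_eq_add_of_le' hi
  have h : (fibonacciIndex G : ℝ) ≤ 104 * 2 ^ t := by
    have := fibonacciIndex_le_geometric_add_two_pow hα.le hd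
    rw [hn, show t + 5 + 3 - 1 = t + 5 + 1 + 1 by omega, show t + 5 + 1 + 1 - 4 = t + 3 by omega,
      four_thirds_pow_mul_three_halves_pow] at this
    exact this.trans_eq (by ring)
  refine le_upperBound_of_mul_le (j := 1) hn hα (by omega) h ?_
  calc (104 * 2 ^ t * ((t + 5 : ℕ) + (1 : ℕ)) : ℝ) = (104 * t + 624) * 2 ^ t := by push_cast; ring
    _ ≤ (128 * t + 640) * 2 ^ t := by gcongr <;> norm_num
    _ = (t + 5 : ℕ) * 2 ^ (t + 5 + 1 + 1) := by push_cast; ring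

lemma fibonacciIndex_le_upperBound_of_card_eq_add_four (hi : 4 ≤ i) (hn : Nat.card V = i + 4)
    (hα : G.indepNum = i + 1) (hd : 3 ≤ (G.neighborSet v).ncard) :
    (fibonacciIndex G : ℝ) ≤ upperBound (Nat.card V) G.indepNum := by
  obtain ⟨t, rfl⟩ := Nat.exists_eq_add_of_le' hi
  have h : (fibonacciIndex G : ℝ) ≤ 88 * 2 ^ t := by
    have := fibonacciIndex_le_geometric_add_two_pow hα.le hd
    rw [hn, show t + 4 + 4 - 1 = t + 4 + 1 + 2 by omega, show t + 4 + 1 + 2 - 3 = t + 4 by omega,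
      four_thirds_pow_mul_three_halves_pow] at this
    exact this.trans_eq (by ring)
  obtain rfl | ht := Nat.eq_zero_or_pos t
  · rw [pow_zero, mul_one] at h
    rw [le_upperBound_iff (j := 2) hn hα (by omega)]
    refine (mul_le_mul_of_nonneg_right h (by positivity)).trans ?_
    norm_num
  · have ht' : (1 : ℝ) ≤ t := by exact_mod_cast ht
    refine le_upperBound_of_mul_le (j := 2) hn hα (by omega) h ?_
    calc (88 * 2 ^ t * ((t + 4 : ℕ) + (2 : ℕ)) : ℝ) = (88 * t + 528) * 2 ^ t := by push_cast; ring
      _ ≤ (128 * t + 512) * 2 ^ t :=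
        mul_le_mul_of_nonneg_right (by linarith) (by positivity)
      _ = (t + 4 : ℕ) * 2 ^ (t + 4 + 2 + 1) := by push_cast; ring

lemma fibonacciIndex_le_upperBound_of_add_le_mul_pow (hn : Nat.card V = i + m + 3)
    (hα : G.indepNum = i + 1) (hd : 2 ≤ (G.neighborSet v).ncard)
    (him : (i + m + 1 : ℝ) ≤ i * (4 / 3) ^ m) :
    (fibonacciIndex G : ℝ) ≤ upperBound (Nat.card V) G.indepNum := by
  have h : (fibonacciIndex G : ℝ) ≤ 4 * 2 ^ i * (3 / 2) ^ m := by
    have := fibonacciIndex_le_geometric_add_geometric hα.le hd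
    rw [hn, show i + m + 3 - 1 = i + 1 + (m + 1) by omega, four_thirds_pow_mul_three_halves_pow,
      show i + 1 + (m + 1) - 2 = i + m by omega, Nat.add_sub_cancel,
      four_thirds_pow_mul_three_halves_pow] at this
    exact this.trans_eq (by ring)
  have hpow : (4 / 3 : ℝ) ^ m * (3 / 2) ^ m = 2 ^ m := by rw [← mul_pow]; norm_num
  refine le_upperBound_of_mul_le (j := m + 1) hn hα (by omega) h ?_
  calc (4 * 2 ^ i * (3 / 2) ^ m * (i + (m + 1 : ℕ)) : ℝ)
      = 4 * 2 ^ i * (3 / 2) ^ m * (i + m + 1) := by push_cast; ring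
    _ ≤ 4 * 2 ^ i * (3 / 2) ^ m * (i * (4 / 3) ^ m) := by gcongr
    _ = 4 * 2 ^ i * i * ((4 / 3) ^ m * (3 / 2) ^ m) := by ring
    _ = i * 2 ^ (i + (m + 1) + 1) := by rw [hpow]; ring

lemma fibonacciIndex_le_upperBound_of_indepNum_le_three (hn : Nat.card V = i + m + 3)
    (hα : G.indepNum = i + 1) (hV : 8 ≤ Nat.card V) (him : i = 1 ∧ m ≤ 8 ∨ i = 2 ∧ m ≤ 4) :
    (fibonacciIndex G : ℝ) ≤ upperBound (Nat.card V) G.indepNum := by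
  have h : (fibonacciIndex G : ℝ) ≤ (27 / 16) ^ (i + 1) * (4 / 3) ^ (i + m + 3) := by
    rw [← hα, ← hn]
    apply fibonacciIndex_le_of_geometric <;> norm_num
  rw [le_upperBound_iff (j := m + 1) hn hα (by omega)]
  refine (mul_le_mul_of_nonneg_right h (by positivity)).trans ?_
  obtain ⟨rfl, hm⟩ | ⟨rfl, hm⟩ := him
  · have : 4 ≤ m := by omega
    interval_cases m <;> norm_num
  · have : 3 ≤ m := by omega
    interval_cases m <;> norm_num

lemma fibonacciIndex_le_of_card_eq_eight (hG : G.Connected) (hV : Nat.card V = 8)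
    (hα : G.indepNum = 4) (hd : 2 ≤ (G.neighborSet v).ncard) : (fibonacciIndex G : ℝ) ≤ 66 := by
  obtain hd₃ | hd₂ : 3 ≤ (G.neighborSet v).ncard ∨ (G.neighborSet v).ncard = 2 := by omega
  · have := fibonacciIndex_le_geometric_add_geometric hα.le hd₃
    norm_num [hV] at this
    exact_mod_cast this
  · obtain ⟨w, hw⟩ := exists_two_le_ncard_neighborSet_induce hG (v := v) (by omega)
    have hcard : Nat.card ({v}ᶜ : Set V) = 7 := by
      have := card_compl_singleton_add_one v
      omega
    have hB := fibonacciIndex_le_geometric_add_geometric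
      ((indepNum_induce_le G {v}ᶜ).trans hα.le) hw
    have hA := fibonacciIndex_induce_compl_closedNeighborSet_le hα.le hd
    rw [hcard] at hB
    rw [hV] at hA
    norm_num at hA hB
    rw [fibonacciIndex_eq_add G v]
    exact_mod_cast add_le_add hB hA

lemma add_le_mul_four_thirds_pow_of_pos {i m : ℕ} (hi : 1 ≤ i) (hm : 2 ≤ m)
    (h₁ : i = 1 → 9 ≤ m) (h₂ : i = 2 → 5 ≤ m) (h₃ : i = 3 → 3 ≤ m) :
    (i + m + 1 : ℝ) ≤ i * (4 / 3) ^ m := by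
  obtain rfl | rfl | rfl | h₄ : i = 1 ∨ i = 2 ∨ i = 3 ∨ 4 ≤ i := by omega
  · exact add_le_mul_four_thirds_pow hi (by norm_num) (h₁ rfl) (by norm_num)
  · exact add_le_mul_four_thirds_pow hi (by norm_num) (h₂ rfl) (by norm_num)
  · exact add_le_mul_four_thirds_pow hi (by norm_num) (h₃ rfl) (by norm_num)
  · have h₄' : (4 : ℝ) ≤ i := by exact_mod_cast h₄
    refine add_le_mul_four_thirds_pow hi (by norm_num) hm ?_
    norm_num
    linarith

lemma fibonacciIndex_le_upperBound_of_add_five_le_card (hG : G.Connected) (hi : 1 ≤ i)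
    (hm : 2 ≤ m) (hn : Nat.card V = i + m + 3) (hV : 8 ≤ Nat.card V) (hα : G.indepNum = i + 1)
    (hd : 2 ≤ (G.neighborSet v).ncard) :
    (fibonacciIndex G : ℝ) ≤ upperBound (Nat.card V) G.indepNum := by
  by_cases hsmall : i = 1 ∧ m ≤ 8 ∨ i = 2 ∧ m ≤ 4
  · exact fibonacciIndex_le_upperBound_of_indepNum_le_three hn hα hV hsmall
  by_cases h₄₈ : i = 3 ∧ m = 2
  · obtain ⟨rfl, rfl⟩ := h₄₈
    have h := fibonacciIndex_le_of_card_eq_eight hG hn hα hd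
    rw [le_upperBound_iff (j := 3) hn hα (by omega)]
    refine (mul_le_mul_of_nonneg_right h (by positivity)).trans ?_
    norm_num
  · exact fibonacciIndex_le_upperBound_of_add_le_mul_pow hn hα hd
      (add_le_mul_four_thirds_pow_of_pos hi hm (by omega) (by omega) (by omega))

theorem fibonacciIndex_le_upperBound (hG : G.Connected) (hV : 8 ≤ Nat.card V) :
    (fibonacciIndex G : ℝ) ≤ upperBound (Nat.card V) G.indepNum := by
  obtain ⟨v, hv⟩ := exists_card_le_mul_ncard_neighborSet hG
  have hα : 0 < G.indepNum := (indepNum_induce_compl_closedNeighborSet_lt G v).pos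
  have hαn : G.indepNum < Nat.card V := by
    by_contra! h
    rw [Nat.sub_eq_zero_of_le h] at hv
    omega
  obtain ⟨i, hi⟩ := Nat.exists_eq_add_of_lt hα
  obtain ⟨j, hj⟩ := Nat.exists_eq_add_of_lt hαn
  rw [zero_add] at hi
  rw [show Nat.card V - G.indepNum = j + 1 by omega] at hv
  obtain rfl | hi₁ := Nat.eq_zero_or_pos i
  · exact fibonacciIndex_le_upperBound_of_indepNum_eq_one hi
  obtain rfl | rfl | rfl | ⟨m, rfl, hm⟩ : j = 0 ∨ j = 1 ∨ j = 2 ∨ ∃ m, j = m + 1 ∧ 2 ≤ m := by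
    by_cases hj₃ : 3 ≤ j
    · exact Or.inr <| Or.inr <| Or.inr ⟨j - 1, by omega, by omega⟩
    · omega
  · exact fibonacciIndex_le_upperBound_of_card_eq_add_two hi₁ (by omega) hi (v := v) (by omega)
  · exact fibonacciIndex_le_upperBound_of_card_eq_add_three (v := v) (by omega) (by omega) hi
      (by omega)
  · exact fibonacciIndex_le_upperBound_of_card_eq_add_four (v := v) (by omega) (by omega) hi
      (by omega)
  · have hd : 2 ≤ (G.neighborSet v).ncard := by
      by_contra! hd
      have := Nat.mul_le_mul_left (m + 1 + 1) (Nat.le_of_lt_succ hd)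
      omega
    exact fibonacciIndex_le_upperBound_of_add_five_le_card hG hi₁ hm (by omega) hV hi hd

end UpperBound

section Polyhedra

variable {ι E : Type*} [NormedAddCommGroup E] [NormedSpace ℝ E]

/-- The polyhedron cut out by the linear inequalities `f i x ≤ c i`, for `i ∈ s`. -/
def polyhedron (s : Finset ι) (f : ι → StrongDual ℝ E) (c : ι → ℝ) : Set E :=
  {x | ∀ i ∈ s, f i x ≤ c i}

/-- The face of the polyhedron on which the `i`-th inequality is an equality. -/
def polyhedronFace (s : Finset ι) (f : ι → StrongDual ℝ E) (c : ι → ℝ) (i : ι) : Set E :=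
  {x ∈ polyhedron s f c | f i x = c i}

/-- A system of inequalities is irredundant if each of its inequalities is nonconstant and is an
equality at some point where all the others are strict. -/
def IsIrredundant (s : Finset ι) (f : ι → StrongDual ℝ E) (c : ι → ℝ) : Prop :=
  ∀ i ∈ s, f i ≠ 0 ∧ ∃ x, f i x = c i ∧ ∀ j ∈ s, j ≠ i → f j x < c j

variable {s : Finset ι} {f : ι → StrongDual ℝ E} {c : ι → ℝ} {i : ι} {x : E} {B : Set E}

lemma polyhedron_eq_sInter : polyhedron s f c = ⋂₀ ((fun i => {x | f i x ≤ c i}) '' s) := by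
  ext
  simp [polyhedron]

lemma convex_polyhedron : Convex ℝ (polyhedron s f c) := by
  rw [polyhedron_eq_sInter]
  refine convex_sInter ?_
  rintro - ⟨i, -, rfl⟩
  exact convex_halfSpace_le (f i).isLinear (c i)

lemma polyhedron_mem_nhds (hx : ∀ i ∈ s, f i x < c i) : polyhedron s f c ∈ nhds x := by
  refine (Filter.eventually_all_finset s).2 fun i hi => ?_
  filter_upwards [(f i).continuous.continuousAt.eventually_lt_const (hx i hi)] with y hy
  exact hy.le

lemma exists_pos_add_smul_mem {U : Set E} (hU : U ∈ nhds x) (v : E) :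
    ∃ t : ℝ, 0 < t ∧ x + t • v ∈ U := by
  have h : Filter.Tendsto (fun t : ℝ => x + t • v) (nhdsWithin 0 (Set.Ioi 0)) (nhds x) := by
    have : Continuous fun t : ℝ => x + t • v := by fun_prop
    exact tendsto_nhdsWithin_of_tendsto_nhds (this.tendsto' 0 x (by simp))
  obtain ⟨t, ht, ht₀⟩ := ((h.eventually hU).and self_mem_nhdsWithin).exists
  exact ⟨t, ht₀, ht⟩

lemma eq_zero_of_isLocalMax {l : StrongDual ℝ E} (h : IsLocalMax l x) : l = 0 := by
  simpa using h.fderiv_eq_zero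

lemma vectorSpan_eq_top_of_mem_nhds {U : Set E} (hU : U ∈ nhds x) : vectorSpan ℝ U = ⊤ := by
  refine eq_top_iff.2 fun v _ => ?_
  obtain ⟨t, ht, htv⟩ := exists_pos_add_smul_mem hU v
  have h := vsub_mem_vectorSpan ℝ htv (mem_of_mem_nhds hU)
  rw [vsub_eq_sub, add_sub_cancel_left] at h
  exact (Submodule.smul_mem_iff _ ht.ne').1 h

lemma polyhedron_erase_mem_nhds [DecidableEq ι] (hx : ∀ j ∈ s, j ≠ i → f j x < c j) :
    polyhedron (s.erase i) f c ∈ nhds x :=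
  polyhedron_mem_nhds fun j hj => hx j (Finset.mem_of_mem_erase hj) (Finset.ne_of_mem_erase hj)

lemma mem_polyhedron_of_mem_erase [DecidableEq ι] (hx : x ∈ polyhedron (s.erase i) f c)
    (hi : f i x ≤ c i) : x ∈ polyhedron s f c := by
  intro j hj
  obtain rfl | hji := eq_or_ne j i
  · exact hi
  · exact hx j (Finset.mem_erase.2 ⟨hji, hj⟩)

lemma polyhedronFace_eq_toExposed (hx : x ∈ polyhedronFace s f c i) (hi : i ∈ s) :
    polyhedronFace s f c i = (f i).toExposed (polyhedron s f c) := by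
  ext y
  refine and_congr_right fun hy => ⟨fun h z hz => (hz i hi).trans_eq h.symm, fun h => ?_⟩
  exact (hy i hi).antisymm (hx.2.symm.trans_le (h x hx.1))

lemma map_midpoint_lt {l : StrongDual ℝ E} {r : ℝ} {y : E} (hx : l x ≤ r) (hy : l y ≤ r)
    (h : l x < r ∨ l y < r) : l (midpoint ℝ x y) < r := by
  have hmid : l (midpoint ℝ x y) = (l x + l y) / 2 := by
    rw [midpoint_eq_smul_add, map_smul, map_add, invOf_eq_inv, smul_eq_mul]
    ring
  obtain h | h := h <;> linarith

lemma exists_mem_forall_lt (hB : Convex ℝ B) (hB₀ : B.Nonempty) (hBP : B ⊆ polyhedron s f c)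
    (h : ∀ i ∈ s, ∃ y ∈ B, f i y < c i) : ∃ x ∈ B, ∀ i ∈ s, f i x < c i := by
  classical
  suffices ∀ r ⊆ s, ∃ x ∈ B, ∀ i ∈ r, f i x < c i from this s subset_rfl
  intro r
  induction r using Finset.induction_on with
  | empty => exact fun _ => ⟨hB₀.some, hB₀.some_mem, by simp⟩
  | insert i r _ ih =>
    intro hr
    obtain ⟨his, hrs⟩ := Finset.insert_subset_iff.1 hr
    obtain ⟨x, hxB, hx⟩ := ih hrs
    obtain ⟨y, hyB, hy⟩ := h i his
    refine ⟨midpoint ℝ x y, hB.midpoint_mem hxB hyB, fun j hj => ?_⟩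
    obtain rfl | hjr := Finset.mem_insert.1 hj
    · exact map_midpoint_lt (hBP hxB j his) hy.le (Or.inr hy)
    · exact map_midpoint_lt (hx j hjr).le (hBP hyB j (hrs hjr)) (Or.inl (hx j hjr))

lemma exists_subset_polyhedronFace (h : IsFacet (polyhedron s f c) B) :
    ∃ i ∈ s, B ⊆ polyhedronFace s f c i := by
  obtain ⟨hexp, hne, hdim⟩ := h
  obtain ⟨l, hl⟩ := hexp hne
  by_contra! hB
  obtain ⟨x, hxB, hx⟩ := exists_mem_forall_lt (hexp.convex convex_polyhedron) hne hexp.subset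
    fun i hi => by
      obtain ⟨y, hyB, hy⟩ := Set.not_subset.1 (hB i hi)
      exact ⟨y, hyB, (hexp.subset hyB i hi).lt_of_ne fun hyi => hy ⟨hexp.subset hyB, hyi⟩⟩
  have hl₀ : l = 0 := by
    apply eq_zero_of_isLocalMax (x := x)
    filter_upwards [polyhedron_mem_nhds hx] with y hy
    exact (hl ▸ hxB).2 y hy
  have hBP : B = polyhedron s f c := by simp [hl, hl₀]
  rw [hBP] at hdim
  omega

lemma isIrredundant_of_forall_exists_pair (hf : ∀ i ∈ s, f i ≠ 0)
    (h : ∀ i ∈ s, ∃ x ∈ polyhedronFace s f c i, ∃ y ∈ polyhedronFace s f c i,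
      ∀ j ∈ s, j ≠ i → f j x < c j ∨ f j y < c j) : IsIrredundant s f c := by
  intro i hi
  obtain ⟨x, hx, y, hy, hxy⟩ := h i hi
  refine ⟨hf i hi, midpoint ℝ x y, ?_, fun j hj hji => ?_⟩
  · rw [midpoint_eq_smul_add, map_smul, map_add, hx.2, hy.2, invOf_eq_inv, smul_eq_mul]
    ring
  · exact map_midpoint_lt (hx.1 j hj) (hy.1 j hj) (hxy j hj hji)

namespace IsIrredundant

lemma not_polyhedron_erase_subset [DecidableEq ι] (h : IsIrredundant s f c) (hi : i ∈ s) :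
    ¬ polyhedron (s.erase i) f c ⊆ polyhedron s f c := by
  intro hsub
  obtain ⟨hfi, x, hxi, hx⟩ := h i hi
  refine hfi (eq_zero_of_isLocalMax (x := x) ?_)
  filter_upwards [polyhedron_erase_mem_nhds hx] with y hy
  exact (hsub hy i hi).trans_eq hxi.symm

lemma polyhedron_ne_sInter (h : IsIrredundant s f c) {T : Set (Set E)}
    (hT : T ⊂ (fun i => {x | f i x ≤ c i}) '' s) : polyhedron s f c ≠ ⋂₀ T := by
  classical
  obtain ⟨hsub, H, ⟨i, hi, rfl⟩, hiT⟩ := Set.ssubset_iff_exists.1 hT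
  intro heq
  refine h.not_polyhedron_erase_subset hi (heq ▸ fun x hx => Set.mem_sInter.2 fun H hH => ?_)
  obtain ⟨j, hj, rfl⟩ := hsub hH
  exact hx j (Finset.mem_erase.2 ⟨by rintro rfl; exact hiT hH, hj⟩)

lemma exists_mem_polyhedronFace (h : IsIrredundant s f c) (hi : i ∈ s) :
    ∃ x ∈ polyhedronFace s f c i, ∀ j ∈ s, j ≠ i → f j x < c j := by
  classical
  obtain ⟨-, x, hxi, hx⟩ := h i hi
  exact ⟨x, ⟨mem_polyhedron_of_mem_erase (mem_of_mem_nhds (polyhedron_erase_mem_nhds hx)) hxi.le,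
    hxi⟩, hx⟩

lemma vectorSpan_polyhedronFace (h : IsIrredundant s f c) (hi : i ∈ s) :
    vectorSpan ℝ (polyhedronFace s f c i) = (f i).ker := by
  classical
  obtain ⟨-, x, hxi, hx⟩ := h i hi
  have hU := polyhedron_erase_mem_nhds hx
  apply le_antisymm
  · rw [vectorSpan_def, Submodule.span_le]
    rintro - ⟨y, hy, z, hz, rfl⟩
    simp [hy.2, hz.2]
  · intro v hv
    have hface {y : E} (hy : y ∈ polyhedron (s.erase i) f c) (hyi : f i y = c i) :
        y ∈ polyhedronFace s f c i := ⟨mem_polyhedron_of_mem_erase hy hyi.le, hyi⟩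
    obtain ⟨t, ht, htv⟩ := exists_pos_add_smul_mem hU v
    have hvi : f i v = 0 := hv
    have := vsub_mem_vectorSpan ℝ (hface htv (by simp [hxi, hvi]))
      (hface (mem_of_mem_nhds hU) hxi)
    rw [vsub_eq_sub, add_sub_cancel_left] at this
    exact (Submodule.smul_mem_iff _ ht.ne').1 this

lemma eq_of_polyhedronFace_subset {j : ι} (h : IsIrredundant s f c) (hi : i ∈ s) (hj : j ∈ s)
    (hij : polyhedronFace s f c i ⊆ polyhedronFace s f c j) : i = j := by
  obtain ⟨x, hxi, hx⟩ := h.exists_mem_polyhedronFace hi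
  by_contra hne
  exact (hx j hj (Ne.symm hne)).ne (hij hxi).2

lemma exists_mem_polyhedron_lt (h : IsIrredundant s f c) (hi : i ∈ s) :
    ∃ y ∈ polyhedron s f c, f i y < c i := by
  classical
  obtain ⟨hfi, x, hxi, hx⟩ := h i hi
  obtain ⟨v, hv⟩ := DFunLike.ne_iff.1 hfi
  obtain ⟨t, ht, hty⟩ := exists_pos_add_smul_mem (polyhedron_erase_mem_nhds hx) (-(f i v) • v)
  have hlt : f i (x + t • -(f i v) • v) < c i := by
    have : 0 < t * (f i v * f i v) := mul_pos ht (mul_self_pos.2 hv)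
    simp only [map_add, map_smul, smul_eq_mul, hxi]
    linarith
  exact ⟨_, mem_polyhedron_of_mem_erase hty hlt.le, hlt⟩

lemma vectorSpan_polyhedron (h : IsIrredundant s f c) :
    vectorSpan ℝ (polyhedron s f c) = ⊤ := by
  have hne : (polyhedron s f c).Nonempty := by
    obtain rfl | ⟨i, hi⟩ := s.eq_empty_or_nonempty
    · exact ⟨0, by simp [polyhedron]⟩
    · obtain ⟨y, hy, -⟩ := h.exists_mem_polyhedron_lt hi
      exact ⟨y, hy⟩
  obtain ⟨x, -, hx⟩ := exists_mem_forall_lt convex_polyhedron hne subset_rfl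
    fun i hi => h.exists_mem_polyhedron_lt hi
  exact vectorSpan_eq_top_of_mem_nhds (polyhedron_mem_nhds hx)

variable [FiniteDimensional ℝ E]

lemma finrank_vectorSpan_polyhedronFace (h : IsIrredundant s f c) (hi : i ∈ s) :
    Module.finrank ℝ (vectorSpan ℝ (polyhedronFace s f c i)) + 1 =
      Module.finrank ℝ (vectorSpan ℝ (polyhedron s f c)) := by
  rw [h.vectorSpan_polyhedron, finrank_top, h.vectorSpan_polyhedronFace hi]
  refine Module.Dual.finrank_ker_add_one_of_ne_zero (f := (f i : E →ₗ[ℝ] ℝ)) fun h₀ => ?_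
  exact (h i hi).1 (ContinuousLinearMap.coe_injective h₀)

lemma isFacet_polyhedronFace (h : IsIrredundant s f c) (hi : i ∈ s) :
    IsFacet (polyhedron s f c) (polyhedronFace s f c i) := by
  obtain ⟨x, hx, -⟩ := h.exists_mem_polyhedronFace hi
  exact ⟨fun _ => ⟨f i, polyhedronFace_eq_toExposed hx hi⟩, ⟨x, hx⟩,
    h.finrank_vectorSpan_polyhedronFace hi⟩

lemma eq_polyhedronFace_of_subset (h : IsIrredundant s f c) (hi : i ∈ s)
    (hB : IsFacet (polyhedron s f c) B) (hBi : B ⊆ polyhedronFace s f c i) :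
    B = polyhedronFace s f c i := by
  obtain ⟨hexp, hne, hdim⟩ := hB
  obtain ⟨l, hl⟩ := hexp hne
  obtain ⟨b, hb⟩ := hne
  have hspan : vectorSpan ℝ B = vectorSpan ℝ (polyhedronFace s f c i) := by
    refine Submodule.eq_of_le_of_finrank_eq (vectorSpan_mono ℝ hBi) ?_
    have := h.finrank_vectorSpan_polyhedronFace hi
    omega
  have hker : vectorSpan ℝ B ≤ l.ker := by
    rw [vectorSpan_def, Submodule.span_le]
    rintro - ⟨y, hy, z, hz, rfl⟩
    rw [hl] at hy hz
    simpa [sub_eq_zero] using (hz.2 y hy.1).antisymm (hy.2 z hz.1)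
  refine hBi.antisymm fun y hy => ?_
  have hyb : l (y - b) = 0 := hker (hspan ▸ vsub_mem_vectorSpan ℝ hy (hBi hb))
  rw [map_sub, sub_eq_zero] at hyb
  rw [hl] at hb ⊢
  exact ⟨hy.1, fun z hz => (hb.2 z hz).trans_eq hyb.symm⟩

theorem isFacet_iff (h : IsIrredundant s f c) :
    IsFacet (polyhedron s f c) B ↔ ∃ i ∈ s, B = polyhedronFace s f c i := by
  constructor
  · intro hB
    obtain ⟨i, hi, hBi⟩ := exists_subset_polyhedronFace hB
    exact ⟨i, hi, h.eq_polyhedronFace_of_subset hi hB hBi⟩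
  · rintro ⟨i, hi, rfl⟩
    exact h.isFacet_polyhedronFace hi

theorem ncard_facets (h : IsIrredundant s f c) :
    {B | IsFacet (polyhedron s f c) B}.ncard = s.card := by
  have hfacets : {B | IsFacet (polyhedron s f c) B} = polyhedronFace s f c '' s := by
    ext B
    simp [h.isFacet_iff, eq_comm]
  have hinj : Set.InjOn (polyhedronFace s f c) s := fun i hi j hj hij =>
    h.eq_of_polyhedronFace_subset hi hj hij.subset
  rw [hfacets, hinj.ncard_image, Set.ncard_coe_finset]

end IsIrredundant

end Polyhedra

section PlaneLines

variable {s t a b x y : ℝ} {g : ℝ → ℝ} {C : Set (ℝ × ℝ)}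

lemma mk_mem_of_convex_of_vertical (hC : Convex ℝ C) (ha : (x, a) ∈ C) (hb : (x, b) ∈ C)
    (hay : a ≤ y) (hyb : y ≤ b) : (x, y) ∈ C := by
  have h := hC.affine_preimage ((AffineMap.const ℝ ℝ x).prod (AffineMap.id ℝ ℝ))
  exact h.ordConnected.out ha hb ⟨hay, hyb⟩

lemma mk_mem_of_convex_of_affine (hC : Convex ℝ C) (hg : ∀ x, g x = s * x + t)
    (ha : (a, g a) ∈ C) (hb : (b, g b) ∈ C) (hax : a ≤ x) (hxb : x ≤ b) : (x, g x) ∈ C := by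
  have h := hC.affine_preimage
    ((AffineMap.id ℝ ℝ).prod (s • AffineMap.id ℝ ℝ + AffineMap.const ℝ ℝ t))
  simp only [hg] at ha hb ⊢
  exact h.ordConnected.out ha hb ⟨hax, hxb⟩

lemma affineSpan_pair_eq_graph (hg : ∀ x, g x = s * x + t) (hab : a ≠ b) :
    (affineSpan ℝ {(a, g a), (b, g b)} : Set (ℝ × ℝ)) = {p | p.2 = g p.1} := by
  have hline (r : ℝ) : AffineMap.lineMap (a, g a) (b, g b) r =
      (AffineMap.lineMap a b r, g (AffineMap.lineMap a b r)) := by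
    ext
    · simp [AffineMap.lineMap_apply]
    · simp only [AffineMap.lineMap_apply, hg, Prod.snd_add, Prod.smul_snd, Prod.snd_sub,
        vsub_eq_sub, vadd_eq_add, smul_eq_mul]
      ring
  ext p
  rw [SetLike.mem_coe, mem_affineSpan_pair_iff_exists_lineMap_eq]
  simp only [hline]
  constructor
  · rintro ⟨r, rfl⟩
    rfl
  · intro hp
    refine ⟨(p.1 - a) / (b - a), ?_⟩
    have hx : AffineMap.lineMap a b ((p.1 - a) / (b - a)) = p.1 := by
      rw [AffineMap.lineMap_apply, smul_eq_mul, vsub_eq_sub, vadd_eq_add,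
        div_mul_cancel₀ _ (sub_ne_zero.2 hab.symm), sub_add_cancel]
    rw [hx, ← hp]

end PlaneLines

section BoundarySystem

/-- The slope of the upper line. -/
noncomputable def upperSlope (n : ℕ) : ℝ :=
  ((2 : ℝ) ^ (n - 1) - n) / (n - 2)

/-- The index set of the boundary lines: `some k` stands for the lower line number `k`, and `none`
for the upper line. -/
def boundaryIndices (n : ℕ) : Finset (Option ℕ) :=
  (Finset.Icc 1 (n - 2)).insertNone

/-- The linear parts of the inequalities, written in the form `boundaryForm n i p ≤
boundaryLevel n i`. -/
noncomputable def boundaryForm (n : ℕ) : Option ℕ → StrongDual ℝ (ℝ × ℝ)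
  | none => ContinuousLinearMap.snd ℝ ℝ ℝ - upperSlope n • ContinuousLinearMap.fst ℝ ℝ ℝ
  | some k => ((2 : ℝ) ^ k - 1) • ContinuousLinearMap.fst ℝ ℝ ℝ - ContinuousLinearMap.snd ℝ ℝ ℝ

/-- The constants of the inequalities, written in the form `boundaryForm n i p ≤
boundaryLevel n i`. -/
noncomputable def boundaryLevel (n : ℕ) : Option ℕ → ℝ
  | none => upperBound n 0
  | some k => -lowerBound n k 0

/-- The point of the complete split graph of order `n` with `m` stable vertices. -/
noncomputable def splitVertex (n m : ℕ) : ℝ × ℝ :=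
  (m, 2 ^ m - m + n)

variable {n k m : ℕ} {p : ℝ × ℝ} {x : ℝ}

lemma lowerBound_eq_slope_mul_add (n k : ℕ) (x : ℝ) :
    lowerBound n k x = (2 ^ k - 1) * x + lowerBound n k 0 := by
  simp only [lowerBound]
  ring

lemma upperBound_eq_slope_mul_add (n : ℕ) (x : ℝ) :
    upperBound n x = upperSlope n * x + upperBound n 0 := by
  simp only [upperBound, upperSlope]
  ring

lemma boundaryForm_none_sub (n : ℕ) (p : ℝ × ℝ) :
    boundaryForm n none p - boundaryLevel n none = p.2 - upperBound n p.1 := by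
  simp [boundaryForm, boundaryLevel, upperBound_eq_slope_mul_add n p.1, sub_sub]

lemma boundaryForm_some_sub (n k : ℕ) (p : ℝ × ℝ) :
    boundaryForm n (some k) p - boundaryLevel n (some k) = lowerBound n k p.1 - p.2 := by
  rw [lowerBound_eq_slope_mul_add n k p.1]
  simp only [boundaryForm, boundaryLevel, sub_apply, smul_apply, ContinuousLinearMap.coe_fst',
    ContinuousLinearMap.coe_snd', smul_eq_mul]
  ring

lemma boundaryForm_none_le : boundaryForm n none p ≤ boundaryLevel n none ↔
    p.2 ≤ upperBound n p.1 := by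
  rw [← sub_nonpos, boundaryForm_none_sub, sub_nonpos]

lemma boundaryForm_none_lt : boundaryForm n none p < boundaryLevel n none ↔
    p.2 < upperBound n p.1 := by
  rw [← sub_neg, boundaryForm_none_sub, sub_neg]

lemma boundaryForm_none_eq : boundaryForm n none p = boundaryLevel n none ↔
    p.2 = upperBound n p.1 := by
  rw [← sub_eq_zero, boundaryForm_none_sub, sub_eq_zero]

lemma boundaryForm_some_le : boundaryForm n (some k) p ≤ boundaryLevel n (some k) ↔
    lowerBound n k p.1 ≤ p.2 := by
  rw [← sub_nonpos, boundaryForm_some_sub, sub_nonpos]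

lemma boundaryForm_some_lt : boundaryForm n (some k) p < boundaryLevel n (some k) ↔
    lowerBound n k p.1 < p.2 := by
  rw [← sub_neg, boundaryForm_some_sub, sub_neg]

lemma boundaryForm_some_eq : boundaryForm n (some k) p = boundaryLevel n (some k) ↔
    p.2 = lowerBound n k p.1 := by
  rw [← sub_eq_zero, boundaryForm_some_sub, sub_eq_zero, eq_comm]

lemma boundaryForm_ne_zero (n : ℕ) (i : Option ℕ) : boundaryForm n i ≠ 0 := by
  intro h
  have := DFunLike.congr_fun h ((0, 1) : ℝ × ℝ)
  cases i <;> simp [boundaryForm] at this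

lemma mem_boundaryPolyhedron :
    p ∈ polyhedron (boundaryIndices n) (boundaryForm n) (boundaryLevel n) ↔
      p.2 ≤ upperBound n p.1 ∧ ∀ k ∈ Finset.Icc 1 (n - 2), lowerBound n k p.1 ≤ p.2 := by
  simp only [polyhedron, boundaryIndices, Set.mem_ofPred_eq, Finset.forall_mem_insertNone,
    boundaryForm_none_le, boundaryForm_some_le]

lemma halfPlanes_eq_image (n : ℕ) : halfPlanes n =
    (fun i => {p | boundaryForm n i p ≤ boundaryLevel n i}) '' boundaryIndices n := by
  ext H
  simp only [halfPlanes, boundaryIndices, Set.mem_union, Set.mem_singleton_iff, Set.mem_image,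
    Set.mem_ofPred_eq, SetLike.mem_coe, Option.exists, boundaryForm_none_le, boundaryForm_some_le,
    Finset.none_mem_insertNone, Finset.some_mem_insertNone, Finset.mem_Icc, true_and, and_assoc,
    eq_comm (a := H), or_comm]

lemma card_boundaryIndices (hn : 2 ≤ n) : (boundaryIndices n).card = n - 1 := by
  rw [boundaryIndices, Finset.card_insertNone, Nat.card_Icc]
  omega

lemma mul_two_pow_lt_two_pow (hk : m ≠ k) (hk' : m ≠ k + 1) :
    (2 : ℝ) ^ k * (m + 1 - k) < 2 ^ m := by
  obtain hmk | hmk : m + 1 ≤ k ∨ k + 2 ≤ m := by omega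
  · have h : (m + 1 - k : ℝ) ≤ 0 := sub_nonpos.2 (by exact_mod_cast hmk)
    exact (mul_nonpos_of_nonneg_of_nonpos (by positivity) h).trans_lt (by positivity)
  · obtain ⟨t, rfl⟩ := Nat.exists_eq_add_of_le hmk
    have ht : (t + 1 : ℝ) ≤ 2 ^ t := by exact_mod_cast Nat.lt_two_pow_self
    calc (2 : ℝ) ^ k * ((k + 2 + t : ℕ) + 1 - k) = 2 ^ k * (t + 3) := by push_cast; ring
      _ < 2 ^ k * (4 * 2 ^ t) := by gcongr; linarith
      _ = 2 ^ (k + 2 + t) := by ring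

lemma splitVertex_snd_sub_lowerBound (n k m : ℕ) :
    (splitVertex n m).2 - lowerBound n k m = 2 ^ m - 2 ^ k * (m + 1 - k) := by
  simp only [splitVertex, lowerBound]
  ring

lemma splitVertex_snd_eq_lowerBound (hm : m = k ∨ m = k + 1) :
    (splitVertex n m).2 = lowerBound n k m := by
  rw [← sub_eq_zero, splitVertex_snd_sub_lowerBound]
  obtain rfl | rfl := hm
  · ring
  · push_cast
    ring

lemma lowerBound_lt_splitVertex_snd (hk : m ≠ k) (hk' : m ≠ k + 1) :
    lowerBound n k m < (splitVertex n m).2 := by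
  rw [← sub_pos, splitVertex_snd_sub_lowerBound, sub_pos]
  exact mul_two_pow_lt_two_pow hk hk'

lemma lowerBound_le_splitVertex_snd (n k m : ℕ) : lowerBound n k m ≤ (splitVertex n m).2 := by
  by_cases hm : m = k ∨ m = k + 1
  · exact (splitVertex_snd_eq_lowerBound hm).ge
  · push Not at hm
    exact (lowerBound_lt_splitVertex_snd hm.1 hm.2).le

lemma upperBound_natCast_one (n : ℕ) : upperBound n (1 : ℕ) = (splitVertex n 1).2 := by
  simp only [upperBound, splitVertex, Nat.cast_one]
  ring

lemma upperBound_natCast_sub_one (hn : 3 ≤ n) :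
    upperBound n (n - 1 : ℕ) = (splitVertex n (n - 1)).2 := by
  have hn' : (n : ℝ) - 2 ≠ 0 := sub_ne_zero.2 (by exact_mod_cast (by omega : n ≠ 2))
  have h : ((n - 1 : ℕ) : ℝ) = n - 1 := Nat.cast_pred (by omega)
  simp only [upperBound, splitVertex, h]
  field_simp
  ring

/-- The left-hand side is affine in `x`, and the right-hand side is its interpolation between
`x = 1` and `x = n - 1`. -/
lemma mul_upperBound_sub_lowerBound (hn : 3 ≤ n) (k : ℕ) (x : ℝ) :
    (n - 2) * (upperBound n x - lowerBound n k x) =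
      (n - 1 - x) * ((splitVertex n 1).2 - lowerBound n k (1 : ℕ)) +
        (x - 1) * ((splitVertex n (n - 1)).2 - lowerBound n k (n - 1 : ℕ)) := by
  have h : ((n - 1 : ℕ) : ℝ) = n - 1 := Nat.cast_pred (by omega)
  rw [← upperBound_natCast_sub_one hn, ← upperBound_natCast_one]
  rw [h, Nat.cast_one, upperBound_eq_slope_mul_add n x, upperBound_eq_slope_mul_add n 1,
    upperBound_eq_slope_mul_add n (n - 1), lowerBound_eq_slope_mul_add n k x,
    lowerBound_eq_slope_mul_add n k 1, lowerBound_eq_slope_mul_add n k (n - 1)]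
  ring

lemma splitVertex_snd_lt_upperBound (hm : 1 < m) (hmn : m < n - 1) :
    (splitVertex n m).2 < upperBound n m := by
  have hm' : (1 : ℝ) < m := by exact_mod_cast hm
  have hmn' : (m : ℝ) < n - 1 := lt_sub_iff_add_lt.2 (by exact_mod_cast (by omega : m + 1 < n))
  have h₁ : 0 < (n - 1 - m) * ((splitVertex n 1).2 - lowerBound n m (1 : ℕ)) :=
    mul_pos (sub_pos.2 hmn') (sub_pos.2 (lowerBound_lt_splitVertex_snd (by omega) (by omega)))
  have h₂ : 0 ≤ (m - 1) * ((splitVertex n (n - 1)).2 - lowerBound n m (n - 1 : ℕ)) :=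
    mul_nonneg (sub_nonneg.2 hm'.le) (sub_nonneg.2 (lowerBound_le_splitVertex_snd n m (n - 1)))
  have h := mul_upperBound_sub_lowerBound (by omega : 3 ≤ n) m m
  have h₃ : 0 < (n - 2) * (upperBound n m - lowerBound n m m) := h ▸ add_pos_of_pos_of_nonneg h₁ h₂
  rw [splitVertex_snd_eq_lowerBound (Or.inl rfl)]
  exact sub_pos.1 (pos_of_mul_pos_right h₃ (by linarith))

lemma splitVertex_snd_le_upperBound (hm : 1 ≤ m) (hmn : m ≤ n - 1) :
    (splitVertex n m).2 ≤ upperBound n m := by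
  obtain rfl | hm₁ := eq_or_ne m 1
  · exact (upperBound_natCast_one n).ge
  obtain rfl | hm₂ := eq_or_ne m (n - 1)
  · exact (upperBound_natCast_sub_one (by omega)).ge
  · exact (splitVertex_snd_lt_upperBound (by omega) (by omega)).le

lemma splitVertex_mem_boundaryPolyhedron (hm : 1 ≤ m) (hmn : m ≤ n - 1) :
    splitVertex n m ∈ polyhedron (boundaryIndices n) (boundaryForm n) (boundaryLevel n) :=
  mem_boundaryPolyhedron.2 ⟨splitVertex_snd_le_upperBound hm hmn,
    fun k _ => lowerBound_le_splitVertex_snd n k m⟩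

lemma splitVertex_mem_polyhedronFace_none (hn : 3 ≤ n) (hm : m = 1 ∨ m = n - 1) :
    splitVertex n m ∈
      polyhedronFace (boundaryIndices n) (boundaryForm n) (boundaryLevel n) none := by
  refine ⟨splitVertex_mem_boundaryPolyhedron (by omega) (by omega), boundaryForm_none_eq.2 ?_⟩
  obtain rfl | rfl := hm
  · exact (upperBound_natCast_one n).symm
  · exact (upperBound_natCast_sub_one hn).symm

lemma splitVertex_mem_polyhedronFace_some (hk : k ∈ Finset.Icc 1 (n - 2))
    (hm : m = k ∨ m = k + 1) : splitVertex n m ∈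
      polyhedronFace (boundaryIndices n) (boundaryForm n) (boundaryLevel n) (some k) := by
  obtain ⟨hk₁, hk₂⟩ := Finset.mem_Icc.1 hk
  exact ⟨splitVertex_mem_boundaryPolyhedron (by omega) (by omega),
    boundaryForm_some_eq.2 (splitVertex_snd_eq_lowerBound hm)⟩

lemma boundaryForm_some_splitVertex_lt (hk : m ≠ k) (hk' : m ≠ k + 1) :
    boundaryForm n (some k) (splitVertex n m) < boundaryLevel n (some k) :=
  boundaryForm_some_lt.2 (lowerBound_lt_splitVertex_snd hk hk')

lemma boundaryForm_none_splitVertex_lt (hm : 1 < m) (hmn : m < n - 1) :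
    boundaryForm n none (splitVertex n m) < boundaryLevel n none :=
  boundaryForm_none_lt.2 (splitVertex_snd_lt_upperBound hm hmn)

/-- Every edge joins two vertices, and no other boundary line contains both of them. -/
lemma isIrredundant_boundary (hn : 4 ≤ n) :
    IsIrredundant (boundaryIndices n) (boundaryForm n) (boundaryLevel n) := by
  refine isIrredundant_of_forall_exists_pair (fun i _ => boundaryForm_ne_zero n i) ?_
  rw [boundaryIndices, Finset.forall_mem_insertNone]
  refine ⟨⟨splitVertex n 1, splitVertex_mem_polyhedronFace_none (by omega) (Or.inl rfl),
    splitVertex n (n - 1), splitVertex_mem_polyhedronFace_none (by omega) (Or.inr rfl), ?_⟩,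
    fun k hk => ⟨splitVertex n k, splitVertex_mem_polyhedronFace_some hk (Or.inl rfl),
      splitVertex n (k + 1), splitVertex_mem_polyhedronFace_some hk (Or.inr rfl), ?_⟩⟩
  · refine Finset.forall_mem_insertNone.2 ⟨fun h => absurd rfl h, fun k hk _ => ?_⟩
    obtain rfl | hk₁ := eq_or_ne k 1
    · exact Or.inr (boundaryForm_some_splitVertex_lt (by omega) (by omega))
    · have := (Finset.mem_Icc.1 hk).1
      exact Or.inl (boundaryForm_some_splitVertex_lt (by omega) (by omega))
  · obtain ⟨hk₁, hk₂⟩ := Finset.mem_Icc.1 hk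
    refine Finset.forall_mem_insertNone.2 ⟨fun _ => ?_, fun l _ hl => ?_⟩
    · obtain rfl | hk₃ := eq_or_ne k 1
      · exact Or.inr (boundaryForm_none_splitVertex_lt (by omega) (by omega))
      · exact Or.inl (boundaryForm_none_splitVertex_lt (by omega) (by omega))
    · have hlk : l ≠ k := fun h => hl (congrArg some h)
      obtain rfl | hkl := eq_or_ne k (l + 1)
      · exact Or.inr (boundaryForm_some_splitVertex_lt (by omega) (by omega))
      · exact Or.inl (boundaryForm_some_splitVertex_lt hlk.symm hkl)

lemma fst_mem_Icc_of_mem_boundaryPolyhedron (hn : 4 ≤ n)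
    (hp : p ∈ polyhedron (boundaryIndices n) (boundaryForm n) (boundaryLevel n)) :
    p.1 ∈ Set.Icc (1 : ℝ) (n - 1) := by
  obtain ⟨hU, hL⟩ := mem_boundaryPolyhedron.1 hp
  have hn' : (0 : ℝ) ≤ n - 2 := sub_nonneg.2 (by exact_mod_cast (by omega : 2 ≤ n))
  have hgap {k : ℕ} (hk : k ∈ Finset.Icc 1 (n - 2)) :
      0 ≤ (n - 1 - p.1) * ((splitVertex n 1).2 - lowerBound n k (1 : ℕ)) +
        (p.1 - 1) * ((splitVertex n (n - 1)).2 - lowerBound n k (n - 1 : ℕ)) := by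
    rw [← mul_upperBound_sub_lowerBound (by omega)]
    exact mul_nonneg hn' (sub_nonneg.2 ((hL k hk).trans hU))
  constructor
  · have h := hgap (Finset.mem_Icc.2 ⟨le_rfl, by omega⟩)
    rw [splitVertex_snd_eq_lowerBound (Or.inl rfl), sub_self, mul_zero, zero_add] at h
    exact sub_nonneg.1 (nonneg_of_mul_nonneg_left h
      (sub_pos.2 (lowerBound_lt_splitVertex_snd (by omega) (by omega))))
  · have h := hgap (Finset.mem_Icc.2 ⟨by omega, le_rfl⟩)
    rw [splitVertex_snd_eq_lowerBound (m := n - 1) (k := n - 2) (Or.inr (by omega)), sub_self,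
      mul_zero, add_zero] at h
    exact sub_nonneg.1 (nonneg_of_mul_nonneg_left h
      (sub_pos.2 (lowerBound_lt_splitVertex_snd (by omega) (by omega))))

lemma exists_natCast_le_and_le {N : ℕ} (hN : 1 ≤ N) (hx₁ : 1 ≤ x) (hx₂ : x ≤ N + 1) :
    ∃ k ∈ Finset.Icc 1 N, (k : ℝ) ≤ x ∧ x ≤ (k + 1 : ℕ) := by
  have hfloor : 1 ≤ ⌊x⌋₊ := Nat.le_floor (by exact_mod_cast hx₁)
  obtain h | h := le_total N ⌊x⌋₊
  · exact ⟨N, Finset.mem_Icc.2 ⟨hN, le_rfl⟩, (Nat.le_floor_iff (by linarith)).1 h,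
      by exact_mod_cast hx₂⟩
  · exact ⟨⌊x⌋₊, Finset.mem_Icc.2 ⟨hfloor, h⟩, Nat.floor_le (by linarith),
      by exact_mod_cast (Nat.lt_floor_add_one x).le⟩

/-- Over `[1, n - 1]` the polyhedron lies between the polygonal line through the vertices and the
chord joining the first vertex to the last one. -/
lemma boundaryPolyhedron_subset {C : Set (ℝ × ℝ)} (hn : 4 ≤ n) (hC : Convex ℝ C)
    (hv : ∀ m, 1 ≤ m → m ≤ n - 1 → splitVertex n m ∈ C) :
    polyhedron (boundaryIndices n) (boundaryForm n) (boundaryLevel n) ⊆ C := by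
  intro p hp
  obtain ⟨hx₁, hx₂⟩ := fst_mem_Icc_of_mem_boundaryPolyhedron hn hp
  obtain ⟨hU, hL⟩ := mem_boundaryPolyhedron.1 hp
  obtain ⟨k, hk, hkx, hxk⟩ : ∃ k ∈ Finset.Icc 1 (n - 2), (k : ℝ) ≤ p.1 ∧ p.1 ≤ (k + 1 : ℕ) := by
    refine exists_natCast_le_and_le (by omega) hx₁ (hx₂.trans_eq ?_)
    rw [Nat.cast_sub (by omega)]
    push_cast
    ring
  obtain ⟨hk₁, hk₂⟩ := Finset.mem_Icc.1 hk
  have hlow : (p.1, lowerBound n k p.1) ∈ C := by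
    refine mk_mem_of_convex_of_affine hC (lowerBound_eq_slope_mul_add n k) ?_ ?_ hkx hxk
    · rw [← splitVertex_snd_eq_lowerBound (Or.inl rfl)]
      exact hv k hk₁ (by omega)
    · rw [← splitVertex_snd_eq_lowerBound (Or.inr rfl)]
      exact hv (k + 1) (by omega) (by omega)
  have hupp : (p.1, upperBound n p.1) ∈ C := by
    refine mk_mem_of_convex_of_affine hC (upperBound_eq_slope_mul_add n) (a := (1 : ℕ))
      (b := (n - 1 : ℕ)) ?_ ?_ (by exact_mod_cast hx₁)
      (hx₂.trans_eq (Nat.cast_pred (by omega)).symm)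
    · rw [upperBound_natCast_one]
      exact hv 1 le_rfl (by omega)
    · rw [upperBound_natCast_sub_one (by omega)]
      exact hv (n - 1) (by omega) le_rfl
  exact mk_mem_of_convex_of_vertical hC hlow hupp (hL k hk) hU

end BoundarySystem

section ConnectedPolytope

variable {n : ℕ}

lemma graphPoint_completeSplit {V : Type*} [Fintype V] {S : Finset V} (hS : S.Nonempty) :
    graphPoint (completeSplit S) = splitVertex (Fintype.card V) S.card := by
  rw [graphPoint, splitVertex, indepNum_completeSplit hS, fibonacciIndex_completeSplit,
    Nat.cast_add, Nat.cast_sub S.card_le_univ, Nat.cast_pow, Nat.cast_ofNat, add_sub_assoc',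
    sub_add_eq_add_sub]

lemma graphPoint_top [NeZero n] : graphPoint (⊤ : SimpleGraph (Fin n)) = splitVertex n 1 := by
  rw [← completeSplit_singleton 0, graphPoint_completeSplit (Finset.singleton_nonempty 0),
    Fintype.card_fin, Finset.card_singleton]

lemma graphPoint_starGraph (hn : 2 ≤ n) (c : Fin n) :
    graphPoint (SimpleGraph.starGraph c) = splitVertex n (n - 1) := by
  have hcard : ({c}ᶜ : Finset (Fin n)).card = n - 1 := by
    rw [Finset.card_compl, Fintype.card_fin, Finset.card_singleton]
  have hne : ({c}ᶜ : Finset (Fin n)).Nonempty := Finset.card_pos.1 (by omega)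
  rw [← completeSplit_compl_singleton, graphPoint_completeSplit hne, Fintype.card_fin, hcard]

lemma lowerBound_le_fibonacciIndex {V : Type*} [Fintype V] (G : SimpleGraph V) (k : ℕ) :
    lowerBound (Fintype.card V) k G.indepNum ≤ fibonacciIndex G := by
  obtain ⟨S, hS⟩ := G.exists_isNIndepSet_indepNum
  have hF := fibonacciIndex_completeSplit_le hS.isIndepSet
  rw [← hS.card_eq]
  calc lowerBound (Fintype.card V) k S.card ≤ (splitVertex (Fintype.card V) S.card).2 :=
        lowerBound_le_splitVertex_snd _ k S.card
    _ = fibonacciIndex (completeSplit S) := by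
        rw [fibonacciIndex_completeSplit, splitVertex, Nat.cast_add, Nat.cast_sub S.card_le_univ]
        push_cast
        ring
    _ ≤ fibonacciIndex G := by exact_mod_cast hF

lemma splitVertex_mem_connectedPolytope {m : ℕ} (hm : 1 ≤ m) (hmn : m ≤ n - 1) :
    splitVertex n m ∈ connectedPolytope n := by
  obtain ⟨S, -, hS⟩ := Finset.exists_subset_card_eq (s := (Finset.univ : Finset (Fin n))) (n := m)
    (by rw [Finset.card_univ, Fintype.card_fin]; omega)
  have hne : S.Nonempty := Finset.card_pos.1 (by omega)
  obtain ⟨c, hc⟩ : ∃ c, c ∉ S := by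
    by_contra! h
    rw [Finset.eq_univ_iff_forall.2 h, Finset.card_univ, Fintype.card_fin] at hS
    omega
  refine subset_convexHull ℝ _ ⟨completeSplit S, connected_completeSplit hc, ?_⟩
  rw [graphPoint_completeSplit hne, hS, Fintype.card_fin]

theorem connectedPolytope_eq_polyhedron (hn : 8 ≤ n) : connectedPolytope n =
    polyhedron (boundaryIndices n) (boundaryForm n) (boundaryLevel n) := by
  apply subset_antisymm
  · refine convexHull_min ?_ convex_polyhedron
    rintro - ⟨G, hG, rfl⟩
    have hupp := fibonacciIndex_le_upperBound hG (by rwa [Nat.card_fin])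
    have hlow := lowerBound_le_fibonacciIndex G
    rw [Nat.card_fin] at hupp
    rw [Fintype.card_fin] at hlow
    exact mem_boundaryPolyhedron.2 ⟨hupp, fun k _ => hlow k⟩
  · exact boundaryPolyhedron_subset (by omega) (convex_convexHull ℝ _)
      fun m => splitVertex_mem_connectedPolytope

theorem setOf_eq_upperBound_eq_affineSpan (hn : 3 ≤ n) (c : Fin n) :
    {p : ℝ × ℝ | p.2 = upperBound n p.1} =
      affineSpan ℝ {graphPoint (⊤ : SimpleGraph (Fin n)),
        graphPoint (SimpleGraph.starGraph c)} := by
  have : NeZero n := ⟨by omega⟩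
  rw [graphPoint_top, graphPoint_starGraph (by omega)]
  have h₁ : splitVertex n 1 = (((1 : ℕ) : ℝ), upperBound n (1 : ℕ)) :=
    Prod.ext rfl (upperBound_natCast_one n).symm
  have h₂ : splitVertex n (n - 1) = (((n - 1 : ℕ) : ℝ), upperBound n (n - 1 : ℕ)) :=
    Prod.ext rfl (upperBound_natCast_sub_one hn).symm
  rw [h₁, h₂, affineSpan_pair_eq_graph (upperBound_eq_slope_mul_add n)
    (by exact_mod_cast (by omega : 1 ≠ n - 1))]

end ConnectedPolytope

theorem theorem5p2 (n : ℕ) (hn : 8 ≤ n) :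
    -- the inequalities form a complete and minimal description of the polytope
    connectedPolytope n = ⋂₀ halfPlanes n ∧
    (∀ T : Set (Set (ℝ × ℝ)), T ⊂ halfPlanes n → connectedPolytope n ≠ ⋂₀ T) ∧
    -- each inequality defines a facet, and there is no other facet
    (∀ B : Set (ℝ × ℝ), IsFacet (connectedPolytope n) B ↔
      (∃ k : ℕ, 1 ≤ k ∧ k ≤ n - 2 ∧
        B = {p ∈ connectedPolytope n | p.2 = lowerBound n k p.1}) ∨
      B = {p ∈ connectedPolytope n | p.2 = upperBound n p.1}) ∧
    -- there are exactly `n - 1` facets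
    {B : Set (ℝ × ℝ) | IsFacet (connectedPolytope n) B}.ncard = n - 1 ∧
    -- the upper line is the line through the points of the complete graph and of the star
    (∀ c : Fin n, {p : ℝ × ℝ | p.2 = upperBound n p.1} =
      (affineSpan ℝ {graphPoint (⊤ : SimpleGraph (Fin n)), graphPoint (SimpleGraph.starGraph c)} :
        Set (ℝ × ℝ))) := by
  have hirr := isIrredundant_boundary (n := n) (by omega)
  rw [connectedPolytope_eq_polyhedron hn]
  refine ⟨?_, fun T hT => ?_, fun B => ?_, ?_, setOf_eq_upperBound_eq_affineSpan (by omega)⟩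
  · rw [halfPlanes_eq_image, polyhedron_eq_sInter]
  · exact hirr.polyhedron_ne_sInter (halfPlanes_eq_image n ▸ hT)
  · rw [hirr.isFacet_iff, boundaryIndices, Option.exists, or_comm]
    simp only [polyhedronFace, boundaryForm_none_eq, boundaryForm_some_eq,
      Finset.none_mem_insertNone, Finset.some_mem_insertNone, Finset.mem_Icc, true_and, and_assoc]
  · rw [hirr.ncard_facets, card_boundaryIndices (by omega)]
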